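/- **Theorem.** There exist constants $D, D' > 0$ such that for every integer $k \ge 2$ and every finite simple graph $G$ on at least $D k \ln k$ vertices, at least one of $G$ and its complement $\overline{G}$ has an induced subgraph on exactly $k$ vertices with minimum degree at least $\frac12 (k-1) + D' \sqrt{\frac{k-1}{\ln k}}$. -/

import Mathlib

/-! Encode `G` as a kernel with entries 1 on edges and -1 on non-edges; complementation negates it,
and the degree bound on a `k`-set says that all its row sums are at least some s of order √(k / log
k). For large k, suppose neither sign admits such a set, and put q = √(k log k), ν = 228q.

A maximiser of total − ν·card among sets of at most 6k vertices has row sums at least ν/2. If it had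
k or more vertices, random sampling would leave a `k`-set with row sums at least q ≥ s, so it has
fewer (`IsPenaltyMax.card_lt`). Successive maximisers repel one another: the union of six would have
so negative a total that it breaks the bound for the negated kernel. Hence deleting O(k) vertices
halves the bound for both signs (`exists_penaltyBound_sdiff`), and O(log k) rounds bring it down to
6νk.

More than a large multiple of k log k vertices survive. There discrepancy forces a total of order
N^(3/2), far above νN (`exists_totalSum_large`), and an exchange argument turns it into a
contradiction (`hasRowSumSet_of_totalSum_large`). Small k are covered by Ramsey's theorem. -/

/-- The row sum of the kernel `a` at `v` over the set `S`. -/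
def rowSum {V : Type*} (a : V → V → ℝ) (S : Finset V) (v : V) : ℝ := ∑ u ∈ S, a v u

/-- The sum of the kernel `a` over all ordered pairs from `S` and `T`. -/
def crossSum {V : Type*} (a : V → V → ℝ) (S T : Finset V) : ℝ := ∑ v ∈ S, rowSum a T v

/-- The sum of the kernel `a` over all ordered pairs of elements of `S`. -/
def totalSum {V : Type*} (a : V → V → ℝ) (S : Finset V) : ℝ := crossSum a S S

/-- Symmetric kernels with zero diagonal and off-diagonal entries `1` or `-1`. -/
structure IsSignKernel {V : Type*} (a : V → V → ℝ) : Prop where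
  symm : ∀ u v, a u v = a v u
  diag : ∀ v, a v v = 0
  abs_eq : ∀ u v, u ≠ v → |a u v| = 1

/-- Some `k`-set has all its row sums at least `s`. -/
def HasRowSumSet {V : Type*} (a : V → V → ℝ) (k : ℕ) (s : ℝ) : Prop :=
  ∃ T : Finset V, T.card = k ∧ ∀ v ∈ T, s ≤ rowSum a T v

/-- Every subset of `W` with at most `B` elements has penalised total at most `x`. -/
def PenaltyBound {V : Type*} (a : V → V → ℝ) (ν : ℝ) (B : ℕ) (W : Finset V) (x : ℝ) : Prop :=
  ∀ S ⊆ W, S.card ≤ B → totalSum a S - ν * S.card ≤ x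

/-! ### Sign kernels and penalised maximisers -/

section Kernel

variable {V : Type*} {a : V → V → ℝ}

theorem IsSignKernel.neg (h : IsSignKernel a) : IsSignKernel (-a) :=
  ⟨fun u v => by simp [h.symm u v], fun v => by simp [h.diag],
    fun u v huv => by simpa using h.abs_eq u v huv⟩

theorem IsSignKernel.abs_le (h : IsSignKernel a) (u v : V) : |a u v| ≤ 1 := by
  by_cases huv : u = v
  · subst huv; simp [h.diag]
  · exact (h.abs_eq u v huv).le

theorem rowSum_neg (S : Finset V) (v : V) : rowSum (-a) S v = -rowSum a S v := by
  simp [rowSum]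

theorem crossSum_neg (S T : Finset V) : crossSum (-a) S T = -crossSum a S T := by
  simp [crossSum, rowSum_neg]

theorem totalSum_neg (S : Finset V) : totalSum (-a) S = -totalSum a S := crossSum_neg S S

theorem rowSum_union [DecidableEq V] {S T : Finset V} (h : Disjoint S T) (v : V) :
    rowSum a (S ∪ T) v = rowSum a S v + rowSum a T v := Finset.sum_union h

theorem rowSum_abs_le (h : IsSignKernel a) (S : Finset V) (v : V) : |rowSum a S v| ≤ S.card := by
  refine (Finset.abs_sum_le_sum_abs _ _).trans ?_
  refine (Finset.sum_le_sum fun u _ => h.abs_le v u).trans ?_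
  simp

theorem crossSum_comm (h : IsSignKernel a) (S T : Finset V) : crossSum a S T = crossSum a T S := by
  unfold crossSum rowSum
  rw [Finset.sum_comm]
  simp_rw [h.symm]

theorem crossSum_union_left [DecidableEq V] {S T : Finset V} (h : Disjoint S T) (U : Finset V) :
    crossSum a (S ∪ T) U = crossSum a S U + crossSum a T U := Finset.sum_union h

theorem crossSum_union_right [DecidableEq V] {S T : Finset V} (h : Disjoint S T) (U : Finset V) :
    crossSum a U (S ∪ T) = crossSum a U S + crossSum a U T := by
  simp [crossSum, rowSum_union h, Finset.sum_add_distrib]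

theorem totalSum_union [DecidableEq V] (ha : IsSignKernel a) {S T : Finset V} (h : Disjoint S T) :
    totalSum a (S ∪ T) = totalSum a S + totalSum a T + 2 * crossSum a S T := by
  unfold totalSum
  rw [crossSum_union_left h, crossSum_union_right h, crossSum_union_right h, crossSum_comm ha T S]
  ring

theorem totalSum_insert [DecidableEq V] (ha : IsSignKernel a) {S : Finset V} {v : V} (h : v ∉ S) :
    totalSum a (insert v S) = totalSum a S + 2 * rowSum a S v := by
  rw [Finset.insert_eq, totalSum_union ha (by simpa using h)]
  simp [totalSum, crossSum, rowSum, ha.diag]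

theorem totalSum_erase [DecidableEq V] (ha : IsSignKernel a) {S : Finset V} {v : V} (h : v ∈ S) :
    totalSum a (S.erase v) = totalSum a S - 2 * rowSum a S v := by
  have h1 := totalSum_insert ha (Finset.notMem_erase v S)
  rw [Finset.insert_erase h] at h1
  have h2 : rowSum a (S.erase v) v = rowSum a S v := by
    unfold rowSum
    rw [← Finset.add_sum_erase S _ h, ha.diag, zero_add]
  linarith

theorem totalSum_abs_le (h : IsSignKernel a) (S : Finset V) :
    |totalSum a S| ≤ (S.card : ℝ) ^ 2 := by
  refine (Finset.abs_sum_le_sum_abs _ _).trans ?_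
  refine (Finset.sum_le_sum fun u _ => rowSum_abs_le h S u).trans ?_
  simp [sq]

theorem PenaltyBound.mono {ν : ℝ} {B : ℕ} {W W' : Finset V} {x x' : ℝ}
    (h : PenaltyBound a ν B W x) (hW : W' ⊆ W) (hx : x ≤ x') : PenaltyBound a ν B W' x' :=
  fun S hS hB => (h S (hS.trans hW) hB).trans hx

/-- A maximiser of the penalised total among the subsets of `W` with at most `B` elements. -/
def IsPenaltyMax (a : V → V → ℝ) (ν : ℝ) (B : ℕ) (W S : Finset V) : Prop :=
  S ⊆ W ∧ S.card ≤ B ∧ PenaltyBound a ν B W (totalSum a S - ν * S.card)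

theorem exists_isPenaltyMax (a : V → V → ℝ) (ν : ℝ) (B : ℕ) (W : Finset V) :
    ∃ S, IsPenaltyMax a ν B W S := by
  obtain ⟨S, hS, hmax⟩ := (W.powerset.filter fun S => S.card ≤ B).exists_max_image
    (fun S => totalSum a S - ν * S.card) ⟨∅, by simp⟩
  simp only [Finset.mem_filter, Finset.mem_powerset] at hS hmax
  exact ⟨S, hS.1, hS.2, fun S' h1 h2 => hmax S' ⟨h1, h2⟩⟩

/-- Deleting `v` changes the penalised total by ν minus twice its row sum, which cannot be positive.
-/
theorem IsPenaltyMax.half_le_rowSum [DecidableEq V] (ha : IsSignKernel a) {ν : ℝ} {B : ℕ}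
    {W S : Finset V} (h : IsPenaltyMax a ν B W S) {v : V} (hv : v ∈ S) :
    ν / 2 ≤ rowSum a S v := by
  have h1 := h.2.2 (S.erase v) ((S.erase_subset v).trans h.1)
    ((Finset.card_le_card (S.erase_subset v)).trans h.2.1)
  have h2 := Finset.card_erase_add_one hv
  have h3 : ((S.erase v).card : ℝ) + 1 = S.card := by exact_mod_cast h2
  rw [totalSum_erase ha hv] at h1
  rw [← h3] at h1
  linarith

end Kernel

/-! ### Random subsets and exponential moments -/

section Concentration

/-- Combines exp y ≤ 1 + y + y² for |y| ≤ 1 with 1 + z ≤ exp z. -/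
theorem bernoulli_exp_le {p l x : ℝ} (hp0 : 0 ≤ p) (hp1 : p ≤ 1) (hl0 : 0 ≤ l) (hl1 : l ≤ 1)
    (hx : |x| ≤ 1) : p * Real.exp (l * x) + (1 - p) ≤ Real.exp (p * (l * x) + l ^ 2) := by
  have h1 : |l * x| ≤ l := by
    rw [abs_mul, abs_of_nonneg hl0]; exact mul_le_of_le_one_right hl0 hx
  have h2 := (abs_le.mp (Real.abs_exp_sub_one_sub_id_le (h1.trans hl1))).2
  have h3 : (l * x) ^ 2 ≤ l ^ 2 := sq_le_sq' (abs_le.mp h1).1 (abs_le.mp h1).2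
  have h4 := Real.add_one_le_exp (p * (l * x) + l ^ 2)
  nlinarith [mul_le_mul_of_nonneg_left h2 hp0, sq_nonneg l, mul_le_mul_of_nonneg_left h3 hp0]

/-- The exponential moment of a Bernoulli subset sum. -/
theorem bernoulli_subset_moment_le {V : Type*} [DecidableEq V] (S : Finset V) {p l : ℝ}
    (hp0 : 0 ≤ p) (hp1 : p ≤ 1) (hl0 : 0 ≤ l) (hl1 : l ≤ 1) (f : V → ℝ)
    (hf : ∀ v, |f v| ≤ 1) :
    ∑ T ∈ S.powerset, p ^ T.card * (1 - p) ^ (S \ T).card * Real.exp (l * ∑ v ∈ T, f v)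
      ≤ Real.exp (p * (l * ∑ v ∈ S, f v) + l ^ 2 * S.card) := by
  have h := Finset.prod_add (fun v => p * Real.exp (l * f v)) (fun _ => 1 - p) S
  calc _ = ∏ v ∈ S, (p * Real.exp (l * f v) + (1 - p)) := by
        rw [h]
        refine Finset.sum_congr rfl fun T _ => ?_
        rw [Finset.prod_mul_distrib, Finset.prod_const, Finset.prod_const, ← Real.exp_sum,
          Finset.mul_sum]
        ring
    _ ≤ ∏ v ∈ S, Real.exp (p * (l * f v) + l ^ 2) := by
        refine Finset.prod_le_prod (fun v _ => ?_) fun v _ => bernoulli_exp_le hp0 hp1 hl0 hl1 (hf v)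
        have := Real.exp_pos (l * f v)
        have : 0 ≤ 1 - p := by linarith
        positivity
    _ = _ := by
        rw [← Real.exp_sum, Finset.sum_add_distrib, ← Finset.mul_sum, ← Finset.mul_sum]
        simp [mul_comm]

/-- A union bound for Bernoulli subset sums. -/
theorem exists_subset_sum_le {V ι : Type*} [DecidableEq V] (S : Finset V) (I : Finset ι)
    (f : ι → V → ℝ) (hf : ∀ i v, |f i v| ≤ 1) {p l t : ℝ}
    (hp0 : 0 ≤ p) (hp1 : p ≤ 1) (hl0 : 0 ≤ l) (hl1 : l ≤ 1)
    (hI : I.card * Real.exp (l ^ 2 * S.card - l * t) < 1) :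
    ∃ T ⊆ S, ∀ i ∈ I, ∑ v ∈ T, f i v ≤ p * ∑ v ∈ S, f i v + t := by
  by_contra! hcon
  set w : Finset V → ℝ := fun T => p ^ T.card * (1 - p) ^ (S \ T).card with hw
  have hw0 : ∀ T, 0 ≤ w T := fun T => by
    have : 0 ≤ 1 - p := by linarith
    simp only [hw]; positivity
  have hw1 : ∑ T ∈ S.powerset, w T = 1 := by
    have h := Finset.prod_add (fun _ => p) (fun _ => 1 - p) S
    simpa [hw] using h.symm
  have key : ∀ T ∈ S.powerset,
      w T ≤ ∑ i ∈ I, w T * Real.exp (l * ∑ v ∈ T, f i v) *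
        Real.exp (-(p * (l * ∑ v ∈ S, f i v)) - l * t) := by
    intro T hT
    obtain ⟨i, hi, hlt⟩ := hcon T (Finset.mem_powerset.mp hT)
    refine le_trans ?_ (Finset.single_le_sum (fun j _ => ?_) hi)
    · rw [mul_assoc, ← Real.exp_add]
      refine le_mul_of_one_le_right (hw0 T) (Real.one_le_exp ?_)
      nlinarith [mul_le_mul_of_nonneg_left hlt.le hl0]
    · exact mul_nonneg (mul_nonneg (hw0 T) (Real.exp_pos _).le) (Real.exp_pos _).le
  have h1 := Finset.sum_le_sum key
  rw [hw1, Finset.sum_comm] at h1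
  have h2 : ∀ i ∈ I, ∑ T ∈ S.powerset, w T * Real.exp (l * ∑ v ∈ T, f i v) *
        Real.exp (-(p * (l * ∑ v ∈ S, f i v)) - l * t) ≤ Real.exp (l ^ 2 * S.card - l * t) := by
    intro i _
    rw [← Finset.sum_mul]
    refine (mul_le_mul_of_nonneg_right
      (bernoulli_subset_moment_le S hp0 hp1 hl0 hl1 (f i) (hf i)) (Real.exp_pos _).le).trans ?_
    rw [← Real.exp_add]
    exact Real.exp_le_exp.mpr (by ring_nf; rfl)
  have h3 := h1.trans (Finset.sum_le_sum h2)
  rw [Finset.sum_const, nsmul_eq_mul] at h3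
  linarith

/-- Passing from a set with large row sums to a subset with exactly `k` elements. -/
theorem exists_card_eq_rowSum_ge {V : Type*} [DecidableEq V] {a : V → V → ℝ}
    (ha : IsSignKernel a) {S : Finset V} {k : ℕ} (hk : 0 < k) (hkS : k ≤ S.card) {d l t : ℝ}
    (hd : ∀ v ∈ S, d ≤ rowSum a S v) (hl0 : 0 ≤ l) (hl1 : l ≤ 1)
    (hI : (S.card + 2 : ℝ) * Real.exp (l ^ 2 * S.card - l * t) < 1) :
    HasRowSumSet a k (k / S.card * d - 2 * t) := by
  have hS : (0 : ℝ) < S.card := by exact_mod_cast hk.trans_le hkS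
  have hkS' : (k : ℝ) ≤ S.card := by exact_mod_cast hkS
  set p : ℝ := k / S.card with hp
  have hp0 : 0 ≤ p := by positivity
  have hp1 : p ≤ 1 := (div_le_one hS).mpr hkS'
  -- One constraint per vertex keeps its row sum from dropping; the two constant functions ±1 bound
  -- the size of `T` from both sides.
  obtain ⟨T, hTS, hT⟩ := exists_subset_sum_le S (S.disjSum (Finset.univ : Finset Bool))
    (Sum.elim (fun v u => -a v u) (fun b _ => if b then 1 else -1))
    (by
      rintro (v | b) u
      · simpa using ha.abs_le v u
      · cases b <;> simp) hp0 hp1 hl0 hl1 (t := t)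
    (by simpa [Finset.card_disjSum] using hI)
  have hrow : ∀ v ∈ S, p * d - t ≤ rowSum a T v := by
    intro v hv
    have h := hT (Sum.inl v) (by simpa using hv)
    simp only [Sum.elim_inl, Finset.sum_neg_distrib] at h
    have := mul_le_mul_of_nonneg_left (hd v hv) hp0
    unfold rowSum at *
    linarith
  have hpS : p * S.card = k := by rw [hp]; field_simp
  have hup : (T.card : ℝ) ≤ k + t := by
    have h := hT (Sum.inr true) (by simp)
    simpa [hpS] using h
  have hlo : (k : ℝ) ≤ T.card + t := by
    have h := hT (Sum.inr false) (by simp)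
    simp only [Sum.elim_inr, Finset.sum_const, nsmul_eq_mul] at h
    simp only [Bool.false_eq_true, if_false, mul_neg, mul_one, hpS] at h
    linarith
  -- The size of `T` is within t of k, so trimming or padding to exactly k costs each row sum at
  -- most a further t.
  rcases le_total k T.card with hkT | hkT
  · obtain ⟨T', hT', hc⟩ := Finset.exists_subset_card_eq hkT
    refine ⟨T', hc, fun v hv => ?_⟩
    have h1 := rowSum_union (a := a) (Finset.disjoint_sdiff (s := T') (t := T)) v
    rw [Finset.union_sdiff_of_subset hT'] at h1
    have h2 := (abs_le.mp (rowSum_abs_le ha (T \ T') v)).2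
    have h3 : ((T \ T').card : ℝ) = T.card - k := by
      rw [Finset.card_sdiff_of_subset hT', hc, Nat.cast_sub hkT]
    have := hrow v (hTS (hT' hv))
    linarith
  · obtain ⟨T', hT', hT'S, hc⟩ := Finset.exists_subsuperset_card_eq hTS hkT hkS
    refine ⟨T', hc, fun v hv => ?_⟩
    have h1 := rowSum_union (a := a) (Finset.disjoint_sdiff (s := T) (t := T')) v
    rw [Finset.union_sdiff_of_subset hT'] at h1
    have h2 := (abs_le.mp (rowSum_abs_le ha (T' \ T) v)).1
    have h3 : ((T' \ T).card : ℝ) = k - T.card := by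
      rw [Finset.card_sdiff_of_subset hT', hc, Nat.cast_sub hkT]
    have := hrow v (hT'S hv)
    linarith

end Concentration

/-! ### Peeling maximisers to halve the penalty bound -/

section Halving

variable {V : Type*} [DecidableEq V] {a : V → V → ℝ}

/-- The state after removing `j` successive penalised maximisers, with union `U`, from `W`. -/
def IsPeeling (a : V → V → ℝ) (ν : ℝ) (k : ℕ) (W : Finset V) (j : ℕ) (c : ℝ) (U : Finset V) :
    Prop :=
  U ⊆ W ∧ U.card ≤ j * k ∧
    (∀ S ⊆ W \ U, S.card < k → 2 * crossSum a U S ≤ -(j * (totalSum a S - ν * S.card))) ∧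
    totalSum a U ≤ ν * U.card + c

theorem isPeeling_empty (a : V → V → ℝ) (ν : ℝ) (k : ℕ) (W : Finset V) :
    IsPeeling a ν k W 0 0 ∅ := by
  simp [IsPeeling, totalSum, crossSum]

/-- Any further S' with fewer than k elements leaves `S ∪ S'` within the size limit, so maximality
of `S` makes twice the cross sum at most minus the penalised total of S'. Each peeled set adds one
such inequality. -/
theorem IsPeeling.step (ha : IsSignKernel a) {ν : ℝ} {k : ℕ} {W U S : Finset V} {j : ℕ} {c : ℝ}
    (h : IsPeeling a ν k W j c U) (hS : IsPenaltyMax a ν (6 * k) (W \ U) S) (hSk : S.card < k) :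
    IsPeeling a ν k W (j + 1) (c + (1 - j) * (totalSum a S - ν * S.card)) (U ∪ S) := by
  obtain ⟨hUW, hUc, hcross, htot⟩ := h
  have hdisj : Disjoint U S := Finset.disjoint_sdiff.mono_right hS.1
  have hcard : ((U ∪ S).card : ℝ) = U.card + S.card := by
    exact_mod_cast Finset.card_union_of_disjoint hdisj
  refine ⟨Finset.union_subset hUW (hS.1.trans Finset.sdiff_subset), ?_, ?_, ?_⟩
  · rw [Finset.card_union_of_disjoint hdisj]; nlinarith
  · intro S' hS' hc'
    have hS'U : S' ⊆ W \ U :=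
      hS'.trans (Finset.sdiff_subset_sdiff le_rfl Finset.subset_union_left)
    have hdisj' : Disjoint S S' :=
      (Finset.disjoint_sdiff.mono_right hS').mono_left Finset.subset_union_right
    have h1 := hcross S' hS'U hc'
    have h2 := hS.2.2 (S ∪ S') (Finset.union_subset hS.1 hS'U)
      (by rw [Finset.card_union_of_disjoint hdisj']; omega)
    rw [totalSum_union ha hdisj', Finset.card_union_of_disjoint hdisj'] at h2
    rw [crossSum_union_left hdisj]
    push_cast at h2 ⊢
    linarith
  · have h1 := hcross S hS.1 hSk
    rw [totalSum_union ha hdisj, hcard]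
    linarith

theorem exists_penaltyBound_sdiff (ha : IsSignKernel a) {ν : ℝ} (hν : 0 ≤ ν) {k : ℕ}
    (hsm : ∀ W S, IsPenaltyMax a ν (6 * k) W S → S.card < k) {W : Finset V} {x m : ℝ}
    (hx : PenaltyBound a ν (6 * k) W x) (hx' : PenaltyBound (-a) ν (6 * k) W x)
    (hxm : x ≤ 2 * m) (hm0 : 0 < m) (hm : 6 * ν * k ≤ m) :
    ∃ U ⊆ W, U.card ≤ 6 * k ∧ PenaltyBound a ν (6 * k) (W \ U) m := by
  by_contra! hcon
  have hstep : ∀ j : ℕ, j < 6 → ∀ c U, IsPeeling a ν k W j c U →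
      ∃ S, m ≤ totalSum a S - ν * S.card ∧ totalSum a S - ν * S.card ≤ x ∧
        IsPeeling a ν k W (j + 1) (c + (1 - j) * (totalSum a S - ν * S.card)) (U ∪ S) := by
    intro j hj c U hU
    obtain ⟨S, hS⟩ := exists_isPenaltyMax a ν (6 * k) (W \ U)
    refine ⟨S, ?_, hx S (hS.1.trans Finset.sdiff_subset) hS.2.1, hU.step ha hS (hsm _ _ hS)⟩
    by_contra! hlt
    exact hcon U hU.1 (hU.2.1.trans (Nat.mul_le_mul_right k hj.le)) (hS.2.2.mono le_rfl hlt.le)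
  obtain ⟨S₁, _, hb₁, h₁⟩ := hstep 0 (by norm_num) _ _ (isPeeling_empty a ν k W)
  obtain ⟨S₂, hm₂, -, h₂⟩ := hstep 1 (by norm_num) _ _ h₁
  obtain ⟨S₃, hm₃, -, h₃⟩ := hstep 2 (by norm_num) _ _ h₂
  obtain ⟨S₄, hm₄, -, h₄⟩ := hstep 3 (by norm_num) _ _ h₃
  obtain ⟨S₅, hm₅, -, h₅⟩ := hstep 4 (by norm_num) _ _ h₄
  obtain ⟨S₆, hm₆, -, hUW, hUc, -, htot⟩ := hstep 5 (by norm_num) _ _ h₅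
  -- The weights 1 − j for j = 0, …, 5 bound the penalised total of the union by x − 10m ≤ −8m.
  -- Negating the kernel gives at least 8m − 12νk ≥ 6m, which exceeds x ≤ 2m.
  have hneg := hx' _ hUW (by simpa using hUc)
  rw [totalSum_neg] at hneg
  have hUc' : (((∅ ∪ S₁ ∪ S₂ ∪ S₃ ∪ S₄ ∪ S₅ ∪ S₆ : Finset V)).card : ℝ) ≤ 6 * k := by
    exact_mod_cast hUc
  have := mul_le_mul_of_nonneg_left hUc' hν
  push_cast at htot
  linarith

theorem exists_penaltyBound_sdiff_both (ha : IsSignKernel a) {ν : ℝ} (hν : 0 ≤ ν) {k : ℕ}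
    (hsm : ∀ W S, IsPenaltyMax a ν (6 * k) W S → S.card < k)
    (hsm' : ∀ W S, IsPenaltyMax (-a) ν (6 * k) W S → S.card < k) {W : Finset V} {x m : ℝ}
    (hx : PenaltyBound a ν (6 * k) W x) (hx' : PenaltyBound (-a) ν (6 * k) W x)
    (hxm : x ≤ 2 * m) (hm0 : 0 < m) (hm : 6 * ν * k ≤ m) :
    ∃ W' ⊆ W, W.card ≤ W'.card + 12 * k ∧ PenaltyBound a ν (6 * k) W' m ∧
      PenaltyBound (-a) ν (6 * k) W' m := by
  obtain ⟨U, hU, hUc, h⟩ := exists_penaltyBound_sdiff ha hν hsm hx hx' hxm hm0 hm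
  obtain ⟨U', hU', hUc', h'⟩ := exists_penaltyBound_sdiff ha.neg hν hsm' hx'
    (by rwa [neg_neg]) hxm hm0 hm
  refine ⟨W \ (U ∪ U'), Finset.sdiff_subset, ?_,
    h.mono (Finset.sdiff_subset_sdiff le_rfl Finset.subset_union_left) le_rfl,
    h'.mono (Finset.sdiff_subset_sdiff le_rfl Finset.subset_union_right) le_rfl⟩
  have h1 := Finset.card_sdiff_add_card_eq_card (Finset.union_subset hU hU')
  have h2 := Finset.card_union_le U U'
  omega

theorem exists_penaltyBound_iterate (ha : IsSignKernel a) {ν : ℝ} (hν : 0 < ν) {k : ℕ}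
    (hk : 0 < k)
    (hsm : ∀ W S, IsPenaltyMax a ν (6 * k) W S → S.card < k)
    (hsm' : ∀ W S, IsPenaltyMax (-a) ν (6 * k) W S → S.card < k) {W : Finset V} {x : ℝ}
    (hx : PenaltyBound a ν (6 * k) W x) (hx' : PenaltyBound (-a) ν (6 * k) W x) (R : ℕ) :
    ∃ W' ⊆ W, W.card ≤ W'.card + 12 * k * R ∧
      PenaltyBound a ν (6 * k) W' (max (x / 2 ^ R) (6 * ν * k)) ∧
      PenaltyBound (-a) ν (6 * k) W' (max (x / 2 ^ R) (6 * ν * k)) := by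
  induction R with
  | zero =>
    exact ⟨W, le_rfl, by simp, hx.mono le_rfl (by simp), hx'.mono le_rfl (by simp)⟩
  | succ R ih =>
    obtain ⟨W₁, hW₁, hc₁, h₁, h₁'⟩ := ih
    have hk' : (0 : ℝ) < k := by exact_mod_cast hk
    have hpos : 0 < 6 * ν * k := by positivity
    obtain ⟨W₂, hW₂, hc₂, h₂, h₂'⟩ := exists_penaltyBound_sdiff_both ha hν.le hsm hsm' h₁ h₁'
      (m := max (x / 2 ^ (R + 1)) (6 * ν * k))
      (by
        refine max_le ?_ ?_
        · refine le_trans (le_of_eq ?_) (mul_le_mul_of_nonneg_left (le_max_left _ _) zero_le_two)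
          rw [pow_succ]; field_simp
        · linarith [le_max_right (x / 2 ^ (R + 1)) (6 * ν * k)])
      (lt_of_lt_of_le hpos (le_max_right _ _)) (le_max_right _ _)
    exact ⟨W₂, hW₂.trans hW₁, by rw [mul_add]; omega, h₂, h₂'⟩

end Halving

/-! ### Discrepancy of order N^(3/2) -/

section Discrepancy

/-- An even quartic below |z| and tangent to it at |z| = s: second and fourth moments then bound the
first moment from below. -/
theorem abs_ge_quartic {z s : ℝ} (hs : 0 < s) : (3 * z ^ 2 * s ^ 2 - z ^ 4) / (2 * s ^ 3) ≤ |z| := by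
  rw [div_le_iff₀ (by positivity)]
  have h : 0 ≤ |z| * ((|z| - s) ^ 2 * (|z| + 2 * s)) := by positivity
  have h2 : |z| ^ 2 = z ^ 2 := sq_abs z
  have h4 : |z| ^ 4 = z ^ 4 := by rw [show (4 : ℕ) = 2 * 2 from rfl, pow_mul, pow_mul, h2]
  nlinarith

variable {V : Type*} [DecidableEq V]

/-- The signed sum of `f` over `S` with sign `1` on `X` and `-1` elsewhere. -/
def signedSum (f : V → ℝ) (S X : Finset V) : ℝ := ∑ u ∈ S, if u ∈ X then f u else -f u

theorem signedSum_moments (f : V → ℝ) (S : Finset V) (hf : ∀ v ∈ S, f v ^ 2 = 1) :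
    ∑ X ∈ S.powerset, signedSum f S X ^ 2 = 2 ^ S.card * (S.card : ℝ) ∧
    ∑ X ∈ S.powerset, signedSum f S X ^ 4 ≤ 2 ^ S.card * (3 * (S.card : ℝ) ^ 2) := by
  induction S using Finset.induction_on with
  | empty => simp [signedSum]
  | insert v S hv ih =>
    obtain ⟨ih2, ih4⟩ := ih fun u hu => hf u (Finset.mem_insert_of_mem hu)
    have hfv := hf v (Finset.mem_insert_self v S)
    have e1 : ∀ X ∈ S.powerset, signedSum f (insert v S) X = signedSum f S X - f v := by
      intro X hX
      have : v ∉ X := fun h => hv (Finset.mem_powerset.mp hX h)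
      simp [signedSum, Finset.sum_insert hv, this]; ring
    have e2 : ∀ X ∈ S.powerset, signedSum f (insert v S) (insert v X) = signedSum f S X + f v := by
      intro X hX
      have : ∑ u ∈ S, (if u ∈ insert v X then f u else -f u) = signedSum f S X := by
        refine Finset.sum_congr rfl fun u hu => ?_
        have : u ≠ v := fun h => hv (h ▸ hu)
        simp [this]
      simp only [signedSum, Finset.sum_insert hv, Finset.mem_insert_self, if_true] at this ⊢
      rw [this]; ring
    have hfv4 : f v ^ 4 = 1 := by
      rw [show (4 : ℕ) = 2 * 2 from rfl, pow_mul, hfv]; norm_num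
    rw [Finset.sum_powerset_insert hv, Finset.sum_powerset_insert hv, Finset.card_insert_of_notMem hv,
      ← Finset.sum_add_distrib, ← Finset.sum_add_distrib]
    constructor
    · calc _ = ∑ X ∈ S.powerset, (2 * signedSum f S X ^ 2 + 2) := by
            refine Finset.sum_congr rfl fun X hX => ?_
            rw [e1 X hX, e2 X hX]; linear_combination 2 * hfv
        _ = _ := by
            rw [Finset.sum_add_distrib, ← Finset.mul_sum, ih2]
            simp [Finset.card_powerset, pow_succ]; ring
    · calc _ = ∑ X ∈ S.powerset, (2 * signedSum f S X ^ 4 + 12 * signedSum f S X ^ 2 + 2) := by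
            refine Finset.sum_congr rfl fun X hX => ?_
            rw [e1 X hX, e2 X hX]
            linear_combination 12 * signedSum f S X ^ 2 * hfv + 2 * hfv4
        _ ≤ _ := by
            rw [Finset.sum_add_distrib, Finset.sum_add_distrib, ← Finset.mul_sum, ← Finset.mul_sum, ih2]
            simp only [Finset.sum_const, Finset.card_powerset, nsmul_eq_mul, pow_succ (2 : ℝ)]
            push_cast
            have : (0 : ℝ) < 2 ^ S.card := by positivity
            nlinarith

/-- A Khintchine inequality for random signs. -/
theorem le_sum_abs_signedSum (f : V → ℝ) (S : Finset V) (hf : ∀ v ∈ S, f v ^ 2 = 1) :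
    2 ^ S.card * Real.sqrt S.card / 2 ≤ ∑ X ∈ S.powerset, |signedSum f S X| := by
  rcases S.eq_empty_or_nonempty with rfl | hne
  · simp [signedSum]
  obtain ⟨h2, h4⟩ := signedSum_moments f S hf
  have hS : (0 : ℝ) < S.card := by exact_mod_cast hne.card_pos
  set q := Real.sqrt S.card with hq
  have hq0 : 0 < q := Real.sqrt_pos.mpr hS
  have hqq : q ^ 2 = S.card := Real.sq_sqrt hS.le
  have hP : (0 : ℝ) < 2 ^ S.card := by positivity
  -- With scale 2√n the moments give (12 − 3)/16 · √n, above the required √n/2.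
  have h := Finset.sum_le_sum fun X (_ : X ∈ S.powerset) =>
    abs_ge_quartic (z := signedSum f S X) (s := 2 * q) (by positivity)
  refine le_trans ?_ h
  rw [← Finset.sum_div, Finset.sum_sub_distrib, ← Finset.sum_mul, ← Finset.mul_sum, h2,
    le_div_iff₀ (by positivity)]
  rw [← hqq] at h4 ⊢
  nlinarith [mul_pos hP (pow_pos hq0 4)]

/-- Averaging over sign patterns on `S` gives the constant 1/2. Passing to one sign class of `S`,
then to the vertices of `T` whose row sums share a sign, loses a factor 2 each time. -/
theorem exists_crossSum_large {a : V → V → ℝ} (ha : IsSignKernel a) {S T : Finset V}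
    (hST : Disjoint S T) :
    ∃ X ⊆ S, ∃ Y ⊆ T, T.card * Real.sqrt S.card ≤ 8 * |crossSum a Y X| := by
  have hf : ∀ v ∈ T, ∀ u ∈ S, a v u ^ 2 = 1 := by
    intro v hv u hu
    have hne : v ≠ u := fun h => (Finset.disjoint_left.mp hST) hu (h ▸ hv)
    rw [← sq_abs, ha.abs_eq v u hne]; norm_num
  obtain ⟨X, hX, hsum⟩ : ∃ X ∈ S.powerset, T.card * Real.sqrt S.card / 2 ≤
      ∑ v ∈ T, |signedSum (a v) S X| := by
    refine Finset.exists_le_of_sum_le ⟨∅, by simp⟩ ?_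
    rw [Finset.sum_comm]
    refine le_trans (le_of_eq ?_) (Finset.sum_le_sum fun v hv => le_sum_abs_signedSum (a v) S (hf v hv))
    simp [Finset.card_powerset]; ring
  rw [Finset.mem_powerset] at hX
  have hsplit : ∀ v, |signedSum (a v) S X| ≤ |rowSum a X v| + |rowSum a (S \ X) v| := by
    intro v
    have : signedSum (a v) S X = rowSum a X v - rowSum a (S \ X) v := by
      unfold signedSum rowSum
      rw [← Finset.sum_sdiff hX]
      have h1 : ∑ u ∈ S \ X, (if u ∈ X then a v u else -a v u) = -∑ u ∈ S \ X, a v u := by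
        rw [← Finset.sum_neg_distrib]
        refine Finset.sum_congr rfl fun u hu => ?_
        rw [if_neg (Finset.mem_sdiff.mp hu).2]
      have h2 : ∑ u ∈ X, (if u ∈ X then a v u else -a v u) = ∑ u ∈ X, a v u :=
        Finset.sum_congr rfl fun u hu => if_pos hu
      rw [h1, h2]; ring
    rw [this]; exact abs_sub _ _
  obtain ⟨Z, hZ, hZsum⟩ : ∃ Z ⊆ S, T.card * Real.sqrt S.card / 4 ≤ ∑ v ∈ T, |rowSum a Z v| := by
    have h := hsum.trans (Finset.sum_le_sum fun v _ => hsplit v)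
    rw [Finset.sum_add_distrib] at h
    by_contra! hcon
    linarith [hcon X hX, hcon (S \ X) Finset.sdiff_subset]
  refine ⟨Z, hZ, ?_⟩
  have hpos := Finset.sum_filter_add_sum_filter_not T (fun v => 0 ≤ rowSum a Z v)
    (fun v => |rowSum a Z v|)
  have e1 : ∑ v ∈ T with 0 ≤ rowSum a Z v, |rowSum a Z v| =
      crossSum a (T.filter fun v => 0 ≤ rowSum a Z v) Z :=
    Finset.sum_congr rfl fun v hv => abs_of_nonneg (Finset.mem_filter.mp hv).2
  have e2 : ∑ v ∈ T with ¬ 0 ≤ rowSum a Z v, |rowSum a Z v| =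
      -crossSum a (T.filter fun v => ¬ 0 ≤ rowSum a Z v) Z := by
    unfold crossSum
    rw [← Finset.sum_neg_distrib]
    exact Finset.sum_congr rfl fun v hv => abs_of_neg (not_le.mp (Finset.mem_filter.mp hv).2)
  by_contra! hcon
  have c1 := hcon _ (Finset.filter_subset (fun v => 0 ≤ rowSum a Z v) T)
  have c2 := hcon _ (Finset.filter_subset (fun v => ¬ 0 ≤ rowSum a Z v) T)
  have d1 := le_abs_self (crossSum a (T.filter fun v => 0 ≤ rowSum a Z v) Z)
  have d2 := neg_le_abs (crossSum a (T.filter fun v => ¬ 0 ≤ rowSum a Z v) Z)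
  linarith

/-- Every large set has a subset with total of order at least the power `3/2` of its size. -/
theorem exists_totalSum_large {a : V → V → ℝ} (ha : IsSignKernel a) {W : Finset V}
    (hW : 2 ≤ W.card) :
    ∃ S ⊆ W, W.card * Real.sqrt W.card ≤ 100 * |totalSum a S| := by
  obtain ⟨P, hP, hPc⟩ := Finset.exists_subset_card_eq (s := W) (n := W.card / 2) (by omega)
  have hc : (W \ P).card = W.card - W.card / 2 := by rw [Finset.card_sdiff_of_subset hP, hPc]
  obtain ⟨X, hX, Y, hY, h⟩ := exists_crossSum_large ha (Finset.disjoint_sdiff (s := P) (t := W))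
  have hXY : Disjoint Y X :=
    (Finset.disjoint_sdiff.mono_left hX |>.mono_right hY).symm
  have hun := totalSum_union ha hXY
  have hYW : Y ⊆ W := hY.trans Finset.sdiff_subset
  have hXW : X ⊆ W := hX.trans hP
  have hT : (W.card : ℝ) / 2 ≤ (W \ P).card := by
    rw [div_le_iff₀ two_pos]; exact_mod_cast (by omega : W.card ≤ (W \ P).card * 2)
  have hS : Real.sqrt W.card / 2 ≤ Real.sqrt P.card := by
    refine Real.le_sqrt_of_sq_le ?_
    rw [div_pow, Real.sq_sqrt (Nat.cast_nonneg _), div_le_iff₀ (by norm_num)]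
    exact_mod_cast (by omega : W.card ≤ P.card * 2 ^ 2)
  have hbig : W.card * Real.sqrt W.card ≤ 32 * |crossSum a Y X| := by
    have := mul_le_mul hT hS (by positivity) (Nat.cast_nonneg _)
    linarith
  by_contra! hcon
  have c1 := hcon _ hYW
  have c2 := hcon _ hXW
  have c3 := hcon _ (Finset.union_subset hYW hXW)
  -- Polarisation: a large cross sum makes one of the three totals large.
  have : 2 * |crossSum a Y X| ≤ |totalSum a (Y ∪ X)| + |totalSum a Y| + |totalSum a X| := by
    have e : 2 * crossSum a Y X = totalSum a (Y ∪ X) - totalSum a Y - totalSum a X := by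
      rw [hun]; ring
    rw [← abs_two, ← abs_mul, e]
    exact (abs_sub _ _).trans (add_le_add_left (abs_sub _ _) _)
  linarith [abs_nonneg (crossSum a Y X)]

end Discrepancy

/-! ### The argument for large k -/

section LargeOrder

variable {V : Type*} [DecidableEq V] {a : V → V → ℝ}

theorem HasRowSumSet.mono {V : Type*} {a : V → V → ℝ} {k : ℕ} {s s' : ℝ} (h : HasRowSumSet a k s) (hs : s' ≤ s) :
    HasRowSumSet a k s' := by
  obtain ⟨T, hT, h⟩ := h
  exact ⟨T, hT, fun v hv => hs.trans (h v hv)⟩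

/-- If no `k`-set has large row sums, then penalised maximisers have fewer than `k` elements. -/
theorem IsPenaltyMax.card_lt (ha : IsSignKernel a) {k : ℕ} (hk : 7 ≤ k)
    (hL : Real.log k ≤ k) {s : ℝ} (hs : s ≤ Real.sqrt (k * Real.log k))
    (hno : ¬ HasRowSumSet a k s) {W S : Finset V}
    (hS : IsPenaltyMax a (228 * Real.sqrt (k * Real.log k)) (6 * k) W S) : S.card < k := by
  by_contra! hkS
  apply hno
  have hk' : (7 : ℝ) ≤ k := by exact_mod_cast hk
  have hk0 : (0 : ℝ) < k := by linarith
  have hL0 : 0 < Real.log k := Real.log_pos (by linarith)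
  set L := Real.log k with hLdef
  set q := Real.sqrt (k * L) with hq
  have hq0 : 0 < q := Real.sqrt_pos.mpr (by positivity)
  have hqq : q ^ 2 = k * L := Real.sq_sqrt (by positivity)
  have hSc : (S.card : ℝ) ≤ 6 * k := by exact_mod_cast hS.2.1
  have hkS' : (k : ℝ) ≤ S.card := by exact_mod_cast hkS
  have hl1 : q / k ≤ 1 := by
    rw [div_le_one hk0]
    exact Real.sqrt_le_iff.mpr ⟨hk0.le, by nlinarith⟩
  -- The choice l = q/k, t = 9q gives exponent at most 6L − 9L, so the failure bound is (6k + 2)/k³.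
  -- The row sums left are at least 114q/6 − 18q = q, whence 228.
  have hexp : (q / k) ^ 2 * S.card - q / k * (9 * q) ≤ -(3 * L) := by
    have e1 : (q / k) ^ 2 = L / k := by rw [div_pow, hqq]; field_simp
    have e2 : q / k * (9 * q) = 9 * L := by
      rw [show q / k * (9 * q) = 9 * q ^ 2 / k by ring, hqq]; field_simp
    have e3 : L / k * S.card ≤ L / k * (6 * k) :=
      mul_le_mul_of_nonneg_left hSc (by positivity)
    have e4 : L / k * (6 * k) = 6 * L := by field_simp
    rw [e1, e2]; linarith
  have hI : (S.card + 2 : ℝ) * Real.exp ((q / k) ^ 2 * S.card - q / k * (9 * q)) < 1 := by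
    have h1 : Real.exp (-(3 * L)) = 1 / (k : ℝ) ^ 3 := by
      rw [Real.exp_neg, mul_comm, Real.exp_mul, hLdef, Real.exp_log hk0, one_div]
      norm_cast
    calc _ ≤ (6 * k + 2 : ℝ) * Real.exp (-(3 * L)) := by
          gcongr
      _ < 1 := by
          rw [h1, mul_one_div, div_lt_one (by positivity)]
          nlinarith [mul_pos hk0 hk0, mul_pos hk0 (mul_pos hk0 hk0)]
  refine (exists_card_eq_rowSum_ge ha (by omega) hkS (fun v hv => hS.half_le_rowSum ha hv)
    (div_nonneg hq0.le hk0.le) hl1 hI).mono ?_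
  have h6 : (1 : ℝ) / 6 ≤ k / S.card := by
    rw [div_le_div_iff₀ (by norm_num) (by linarith)]; linarith
  have := mul_le_mul_of_nonneg_right h6 (by positivity : 0 ≤ 228 * q / 2)
  linarith

/-- A set of large discrepancy contains either a `k`-set with large row sums, or a set with at most
`6 * k` elements and large penalised total. -/
theorem hasRowSumSet_of_totalSum_large (ha : IsSignKernel a) {k : ℕ} (hk : 0 < k) {s ν : ℝ}
    (hν : 0 < ν) (hs : 0 ≤ s) {W S₀ : Finset V} (hkW : k ≤ W.card) (hS₀ : S₀ ⊆ W)
    (htot : 64 * ν * W.card ≤ totalSum a S₀) (hsW : (s + 1) * W.card ≤ 8 * ν * k)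
    (hpen : PenaltyBound a ν (6 * k) W (6 * ν * k)) : HasRowSumSet a k s := by
  by_contra hno
  have hk0 : (0 : ℝ) < k := by exact_mod_cast hk
  have hkW' : (k : ℝ) ≤ W.card := by exact_mod_cast hkW
  -- Half the density 64ν is spent as penalty: the maximiser keeps value at least 32ν|W|, too large
  -- for a set of at most 6k elements, and has row sums at least 16ν.
  obtain ⟨S, hS⟩ := exists_isPenaltyMax a (32 * ν) W.card W
  have hval := hS.2.2 S₀ hS₀ (Finset.card_le_card hS₀)
  have hS₀c : (S₀.card : ℝ) ≤ W.card := by exact_mod_cast Finset.card_le_card hS₀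
  have hνS₀ := mul_le_mul_of_nonneg_left hS₀c hν.le
  have hνk := mul_le_mul_of_nonneg_left hkW' hν.le
  have hνk0 : 0 < ν * k := by positivity
  rcases le_or_gt S.card (6 * k) with hc | hc
  · have h := hpen S hS.1 hc
    have : 0 ≤ ν * S.card := by positivity
    linarith
  obtain ⟨T, hT, hTmax⟩ := (S.powersetCard k).exists_max_image (totalSum a)
    (Finset.powersetCard_nonempty.mpr (by omega))
  obtain ⟨hTS, hTc⟩ := Finset.mem_powersetCard.mp hT
  obtain ⟨v, hvT, hv⟩ : ∃ v ∈ T, rowSum a T v < s := by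
    by_contra! hcon
    exact hno ⟨T, hTc, hcon⟩
  -- Exchanging `v` for `u` cannot raise the total of the optimal `T`, so the row sum of `u` exceeds
  -- that of `v` by at most 1.
  have hout : ∀ u ∈ S \ T, rowSum a T u ≤ s + 1 := by
    intro u hu
    obtain ⟨huS, huT⟩ := Finset.mem_sdiff.mp hu
    have hu' : u ∉ T.erase v := fun h => huT (Finset.mem_of_mem_erase h)
    have h := hTmax (insert u (T.erase v)) (Finset.mem_powersetCard.mpr
      ⟨Finset.insert_subset huS ((T.erase_subset v).trans hTS), by
        rw [Finset.card_insert_of_notMem hu', Finset.card_erase_add_one hvT, hTc]⟩)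
    have hrow : rowSum a (T.erase v) u = rowSum a T u - a u v := by
      unfold rowSum
      rw [← Finset.add_sum_erase T _ hvT]; ring
    rw [totalSum_insert ha hu', totalSum_erase ha hvT, hrow] at h
    linarith [(abs_le.mp (ha.abs_le u v)).2]
  have hcross : crossSum a T (S \ T) ≤ (s + 1) * W.card := by
    rw [crossSum_comm ha]
    calc crossSum a (S \ T) T ≤ ∑ _u ∈ S \ T, (s + 1) := Finset.sum_le_sum hout
      _ = (s + 1) * (S \ T).card := by rw [Finset.sum_const, nsmul_eq_mul, mul_comm]
      _ ≤ _ := by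
        have : (S \ T).card ≤ W.card := Finset.card_le_card (Finset.sdiff_subset.trans hS.1)
        gcongr
  have hrows : k * (32 * ν / 2) ≤ crossSum a T S := by
    calc _ = ∑ _v ∈ T, 32 * ν / 2 := by rw [Finset.sum_const, nsmul_eq_mul, hTc]
      _ ≤ _ := Finset.sum_le_sum fun v hv => hS.half_le_rowSum ha (hTS hv)
  have hsplit := crossSum_union_right (a := a) (Finset.disjoint_sdiff (s := T) (t := S)) T
  rw [Finset.union_sdiff_of_subset hTS] at hsplit
  -- Rows give 16νk and the outside takes at most 8νk, so `T` has total at least 8νk, against the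
  -- allowed 7νk.
  have h := hpen T (hTS.trans hS.1) (by omega)
  rw [hTc] at h
  unfold totalSum at h
  linarith

theorem hasRowSumSet_or_neg {V : Type*} [Fintype V] [DecidableEq V] {a : V → V → ℝ}
    (ha : IsSignKernel a) {K : ℝ} (hKdef : K = 1459200 ^ 2) {k : ℕ} (hk : 7 ≤ k)
    (hL1 : 1 ≤ Real.log k) (hKL : K ^ 2 * Real.log k ≤ k)
    (hV : (2 * K + 36) * k * Real.log k ≤ Fintype.card V) :
    HasRowSumSet a k (2 * (K⁻¹ * Real.sqrt ((k - 1) / Real.log k))) ∨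
      HasRowSumSet (-a) k (2 * (K⁻¹ * Real.sqrt ((k - 1) / Real.log k))) := by
  by_contra! hno
  obtain ⟨hno, hno'⟩ := hno
  set s := 2 * (K⁻¹ * Real.sqrt ((k - 1) / Real.log k)) with hsdef
  have hK1 : 1000000 ≤ K := by rw [hKdef]; norm_num
  have hk' : (7 : ℝ) ≤ k := by exact_mod_cast hk
  have hk0 : (0 : ℝ) < k := by linarith
  set L := Real.log k with hLdef
  have hL0 : 0 < L := by linarith
  set q := Real.sqrt (k * L) with hq
  have hq0 : 0 < q := Real.sqrt_pos.mpr (by positivity)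
  have hqq : q ^ 2 = k * L := Real.sq_sqrt (by positivity)
  have hs0 : 0 ≤ s := by positivity
  have hKLq : K * L ≤ q := by
    refine Real.le_sqrt_of_sq_le ?_
    linarith [mul_le_mul_of_nonneg_right hKL hL0.le]
  have hLk : L ≤ k := by nlinarith
  have hsq : s * L ≤ 2 * K⁻¹ * q := by
    have : Real.sqrt ((k - 1) / L) * L ≤ q := by
      refine Real.le_sqrt_of_sq_le ?_
      rw [mul_pow, Real.sq_sqrt (div_nonneg (by linarith) hL0.le)]
      rw [show (k - 1) / L * L ^ 2 = (k - 1) * L by field_simp]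
      nlinarith
    have := mul_le_mul_of_nonneg_left this (by positivity : 0 ≤ 2 * K⁻¹)
    rw [hsdef]; linarith
  have hKinv : K⁻¹ ≤ 1 / 2 := by
    rw [inv_le_comm₀ (by linarith) (by norm_num)]; linarith
  have hs : s ≤ q := by
    have h1 := mul_le_mul_of_nonneg_right hKinv hq0.le
    have h2 := mul_le_mul_of_nonneg_left hL1 hs0
    linarith
  have hsm := fun (W S : Finset V) => IsPenaltyMax.card_lt (W := W) (S := S) ha hk hLk hs hno
  have hsm' := fun (W S : Finset V) => IsPenaltyMax.card_lt (W := W) (S := S) ha.neg hk hLk hs hno'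
  rw [← hLdef, ← hq] at hsm hsm'
  set ν := 228 * q with hν
  have hν0 : 0 < ν := by positivity
  have hinit : ∀ b : V → V → ℝ, IsSignKernel b →
      PenaltyBound b ν (6 * k) Finset.univ (36 * k ^ 2) := by
    intro b hb S _ hSc
    have h1 := (abs_le.mp (totalSum_abs_le hb S)).2
    have h2 : (S.card : ℝ) ≤ 6 * k := by exact_mod_cast hSc
    have h3 : 0 ≤ ν * S.card := by positivity
    have h4 : (0 : ℝ) ≤ S.card := Nat.cast_nonneg _
    nlinarith
  -- Since 2 log 2 > 1, this many halvings divide 36k² by at least k; at most 12k · 3L = 36kL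
  -- vertices are lost.
  obtain ⟨W', -, hcard, hb, hb'⟩ := exists_penaltyBound_iterate ha hν0 (by omega) hsm hsm'
    (hinit a ha) (hinit (-a) ha.neg) ⌈2 * L⌉₊
  have hpow : (k : ℝ) ≤ 2 ^ ⌈2 * L⌉₊ := by
    calc (k : ℝ) = Real.exp L := (Real.exp_log hk0).symm
      _ ≤ Real.exp (Real.log 2 * ⌈2 * L⌉₊) := by
        rw [Real.exp_le_exp]
        have h1 := Nat.le_ceil (2 * L)
        have h2 := Real.log_two_gt_d9
        nlinarith
      _ = _ := by rw [Real.exp_mul, Real.exp_log two_pos, Real.rpow_natCast]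
  have hmax : max (36 * (k : ℝ) ^ 2 / 2 ^ ⌈2 * L⌉₊) (6 * ν * k) ≤ 6 * ν * k := by
    refine max_le ?_ le_rfl
    rw [div_le_iff₀ (by positivity)]
    have : 1 ≤ q := Real.one_le_sqrt.mpr (by nlinarith)
    have h6 : 36 * (k : ℝ) ≤ 6 * ν * k := mul_le_mul_of_nonneg_right (by linarith) hk0.le
    calc 36 * (k : ℝ) ^ 2 = 36 * k * k := by ring
      _ ≤ 6 * ν * k * 2 ^ ⌈2 * L⌉₊ := by gcongr
  have hkL : 1 ≤ k * L := by nlinarith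
  set N := ⌈K * (k * L)⌉₊ with hN
  have hNlo : K * (k * L) ≤ N := Nat.le_ceil _
  have hNhi : (N : ℝ) ≤ 2 * K * (k * L) := by
    have := (Nat.ceil_lt_add_one (by positivity : 0 ≤ K * (k * L))).le
    have := mul_le_mul hK1 hkL zero_le_one (by linarith)
    linarith
  have hR : (⌈2 * L⌉₊ : ℝ) ≤ 3 * L := by
    have := (Nat.ceil_lt_add_one (by positivity : 0 ≤ 2 * L)).le
    linarith
  have hNW : N ≤ W'.card := by
    have h1 : (Fintype.card V : ℝ) ≤ W'.card + 12 * k * ⌈2 * L⌉₊ := by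
      rw [Finset.card_univ] at hcard; exact_mod_cast hcard
    have h2 := mul_le_mul_of_nonneg_left hR (by positivity : (0 : ℝ) ≤ 12 * k)
    have : (N : ℝ) ≤ W'.card := by linarith
    exact_mod_cast this
  obtain ⟨W, hWW', hWc⟩ := Finset.exists_subset_card_eq hNW
  have hkN : (k : ℝ) ≤ N := by
    have h1 := mul_le_mul_of_nonneg_left hL1 hk0.le
    have h2 := mul_le_mul_of_nonneg_right hK1 (by linarith : (0 : ℝ) ≤ k * L)
    linarith
  have hkN' : k ≤ N := by exact_mod_cast hkN
  have hN0 : (0 : ℝ) < N := by linarith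
  obtain ⟨S, hSW, hS⟩ := exists_totalSum_large ha (W := W) (by omega)
  rw [hWc] at hS
  -- Here 1459200 = 100 · 64 · 228, so the discrepancy N^(3/2)/100 reaches 64νN.
  have hsqrt : 1459200 * q ≤ Real.sqrt N := by
    refine Real.le_sqrt_of_sq_le ?_
    rw [mul_pow, hqq, ← hKdef]; exact hNlo
  have htot : 64 * ν * W.card ≤ |totalSum a S| := by
    rw [hWc]
    have := mul_le_mul_of_nonneg_left hsqrt hN0.le
    linarith
  -- This fixes the order of s: with N of order k log k, the product sN must stay O(qk), so s is of
  -- order √(k / log k).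
  have hsW : (s + 1) * W.card ≤ 8 * ν * k := by
    rw [hWc]
    have e1 : s * N ≤ 4 * (q * k) := by
      calc s * N ≤ s * (2 * K * (k * L)) := by gcongr
        _ = 2 * K * k * (s * L) := by ring
        _ ≤ 2 * K * k * (2 * K⁻¹ * q) := by gcongr
        _ = _ := by field_simp; ring
    have e2 : (N : ℝ) ≤ 2 * (q * k) := by
      linarith [mul_le_mul_of_nonneg_left hKLq hk0.le]
    have : 0 < q * k := by positivity
    linarith
  rcases le_total 0 (totalSum a S) with hsgn | hsgn
  · rw [abs_of_nonneg hsgn] at htot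
    exact hno (hasRowSumSet_of_totalSum_large ha (by omega) hν0 hs0 (by omega) hSW htot hsW
      (hb.mono hWW' hmax))
  · rw [abs_of_nonpos hsgn, ← totalSum_neg] at htot
    exact hno' (hasRowSumSet_of_totalSum_large ha.neg (by omega) hν0 hs0 (by omega) hSW htot hsW
      (hb'.mono hWW' hmax))

end LargeOrder

/-! ### Ramsey bound and translation to graphs -/

section Graph

/-- Either the neighbours or the non-neighbours of a vertex make up half of the rest; recurse there
and add the vertex back. -/
theorem exists_isNClique_or_compl {V : Type*} [DecidableEq V] (G : SimpleGraph V)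
    [DecidableRel G.Adj] (r s : ℕ) (W : Finset V) (hW : 2 ^ (r + s) ≤ W.card) :
    ∃ T ⊆ W, G.IsNClique r T ∨ Gᶜ.IsNClique s T := by
  induction hn : r + s generalizing r s W with
  | zero => exact ⟨∅, by simp, Or.inl (by simp [(by omega : r = 0)])⟩
  | succ n ih =>
    rcases Nat.eq_zero_or_pos r with rfl | hr
    · exact ⟨∅, by simp, Or.inl (by simp)⟩
    rcases Nat.eq_zero_or_pos s with rfl | hs
    · exact ⟨∅, by simp, Or.inr (by simp)⟩
    rw [hn, pow_succ] at hW
    obtain ⟨v, hv⟩ : W.Nonempty := Finset.card_pos.mp (lt_of_lt_of_le (by positivity) hW)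
    have h1 := Finset.card_erase_add_one hv
    have h2 := (W.erase v).card_filter_add_card_filter_not (G.Adj v)
    have h3 : 2 ^ n ≤ ((W.erase v).filter (G.Adj v)).card ∨
        2 ^ n ≤ ((W.erase v).filter fun u => ¬ G.Adj v u).card := by omega
    rcases h3 with h3 | h3
    · obtain ⟨T, hT, h⟩ := ih (r - 1) s _ (by rwa [(by omega : r - 1 + s = n)]) (by omega)
      have hTW : T ⊆ W := hT.trans ((Finset.filter_subset _ _).trans (Finset.erase_subset _ _))
      rcases h with h | h
      · refine ⟨insert v T, Finset.insert_subset hv hTW, Or.inl ?_⟩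
        have := h.insert (a := v) fun u hu => (Finset.mem_filter.mp (hT hu)).2
        rwa [Nat.sub_add_cancel hr] at this
      · exact ⟨T, hTW, Or.inr h⟩
    · obtain ⟨T, hT, h⟩ := ih r (s - 1) _ (by rwa [(by omega : r + (s - 1) = n)]) (by omega)
      have hTW : T ⊆ W := hT.trans ((Finset.filter_subset _ _).trans (Finset.erase_subset _ _))
      rcases h with h | h
      · exact ⟨T, hTW, Or.inl h⟩
      · refine ⟨insert v T, Finset.insert_subset hv hTW, Or.inr ?_⟩
        have := h.insert (a := v) fun u hu => by
          obtain ⟨hu1, hu2⟩ := Finset.mem_filter.mp (hT hu)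
          exact (SimpleGraph.compl_adj G v u).mpr ⟨(Finset.ne_of_mem_erase hu1).symm, hu2⟩
        rwa [Nat.sub_add_cancel hs] at this

/-- The kernel equal to `1` on edges and `-1` on non-edges. -/
def adjSign {V : Type*} [DecidableEq V] (G : SimpleGraph V) [DecidableRel G.Adj] (u v : V) : ℝ :=
  if u = v then 0 else if G.Adj u v then 1 else -1

variable {V : Type*} [DecidableEq V] (G : SimpleGraph V) [DecidableRel G.Adj]

theorem isSignKernel_adjSign : IsSignKernel (adjSign G) where
  symm u v := by simp [adjSign, eq_comm, G.adj_comm]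
  diag v := by simp [adjSign]
  abs_eq u v h := by unfold adjSign; rw [if_neg h]; split_ifs <;> simp

theorem adjSign_compl : adjSign Gᶜ = -adjSign G := by
  ext u v
  simp only [adjSign, SimpleGraph.compl_adj, Pi.neg_apply]
  split_ifs <;> simp_all

theorem rowSum_adjSign {T : Finset V} {v : V} (hv : v ∈ T) :
    rowSum (adjSign G) T v = 2 * (T.filter (G.Adj v)).card - (T.card - 1) := by
  have h : ∀ u ∈ T, adjSign G v u = 2 * (if G.Adj v u then 1 else 0) - 1 + if u = v then 1 else 0 := by
    intro u _
    unfold adjSign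
    by_cases huv : v = u
    · subst huv; simp
    · rw [if_neg huv, if_neg (Ne.symm huv)]; split_ifs <;> norm_num
  unfold rowSum
  rw [Finset.sum_congr rfl h, Finset.sum_add_distrib, Finset.sum_sub_distrib, ← Finset.mul_sum,
    Finset.sum_boole, Finset.sum_ite_eq', if_pos hv]
  simp; ring

theorem le_minDegree_of_rowSum {T : Finset V} (hT : T.Nonempty) {x : ℝ}
    (h : ∀ v ∈ T, 2 * x ≤ rowSum (adjSign G) T v) :
    ((T.card : ℝ) - 1) / 2 + x ≤ ((G.induce (T : Set V)).minDegree : ℝ) := by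
  have : Nonempty (T : Set V) := hT.coe_sort
  obtain ⟨⟨v, hv⟩, hmin⟩ := (G.induce (T : Set V)).exists_minimal_degree_vertex
  have hdeg : (G.induce (T : Set V)).degree ⟨v, hv⟩ = (T.filter (G.Adj v)).card := by
    rw [← SimpleGraph.card_neighborFinset_eq_degree]
    refine Finset.card_bij (fun u _ => u.1) ?_ ?_ ?_
    · rintro ⟨u, hu⟩ h
      simpa using ⟨hu, by simpa using h⟩
    · rintro ⟨u, hu⟩ _ ⟨w, hw⟩ _ h
      simpa using h
    · intro u hu
      obtain ⟨h1, h2⟩ := Finset.mem_filter.mp hu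
      exact ⟨⟨u, h1⟩, by simpa using h2, rfl⟩
  rw [hmin, hdeg]
  have := h v hv
  rw [rowSum_adjSign G hv] at this
  linarith

theorem HasRowSumSet.of_isNClique {k : ℕ} {T : Finset V} (h : G.IsNClique k T) :
    HasRowSumSet (adjSign G) k (k - 1) := by
  refine ⟨T, h.card_eq, fun v hv => ?_⟩
  have e : T.filter (G.Adj v) = T.erase v := by
    ext u
    simp only [Finset.mem_filter, Finset.mem_erase]
    constructor
    · exact fun ⟨h1, h2⟩ => ⟨h2.ne', h1⟩
    · exact fun ⟨h1, h2⟩ => ⟨h2, h.isClique hv h2 (Ne.symm h1)⟩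
  have := Finset.card_erase_add_one hv
  have h2 : ((T.erase v).card : ℝ) + 1 = k := by rw [← h.card_eq]; exact_mod_cast this
  rw [rowSum_adjSign G hv, e, h.card_eq]
  linarith

theorem exists_minDegree_of_hasRowSumSet {k : ℕ} (hk : 0 < k) {x : ℝ}
    (h : HasRowSumSet (adjSign G) k (2 * x) ∨ HasRowSumSet (-adjSign G) k (2 * x)) :
    ∃ S : Finset V, S.card = k ∧
      (((k : ℝ) - 1) / 2 + x ≤ ((G.induce (S : Set V)).minDegree : ℝ) ∨
        ((k : ℝ) - 1) / 2 + x ≤ ((Gᶜ.induce (S : Set V)).minDegree : ℝ)) := by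
  rw [← adjSign_compl] at h
  rcases h with ⟨T, rfl, h⟩ | ⟨T, rfl, h⟩
  · exact ⟨T, rfl, Or.inl (le_minDegree_of_rowSum G (Finset.card_pos.mp hk) h)⟩
  · exact ⟨T, rfl, Or.inr (le_minDegree_of_rowSum Gᶜ (Finset.card_pos.mp hk) h)⟩

end Graph

theorem mainTheorem2 :
    ∃ D D' : ℝ, 0 < D ∧ 0 < D' ∧
      ∀ k : ℕ, 2 ≤ k →
        ∀ (V : Type*) [Fintype V] [DecidableEq V] (G : SimpleGraph V) [DecidableRel G.Adj],
          D * (k : ℝ) * Real.log (k : ℝ) ≤ (Fintype.card V : ℝ) →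
          ∃ S : Finset V, S.card = k ∧
            (((k : ℝ) - 1) / 2 + D' * Real.sqrt (((k : ℝ) - 1) / Real.log (k : ℝ)) ≤
                ((G.induce (S : Set V)).minDegree : ℝ) ∨
              ((k : ℝ) - 1) / 2 + D' * Real.sqrt (((k : ℝ) - 1) / Real.log (k : ℝ)) ≤
                ((Gᶜ.induce (S : Set V)).minDegree : ℝ)) := by
  obtain ⟨K, hK⟩ : ∃ K : ℝ, K = 1459200 ^ 2 := ⟨_, rfl⟩
  have hK1 : 1000000 ≤ K := by rw [hK]; norm_num
  have hlarge : ∀ᶠ k : ℕ in Filter.atTop,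
      7 ≤ k ∧ 1 ≤ Real.log k ∧ K ^ 2 * Real.log k ≤ k := by
    refine (Filter.eventually_ge_atTop 7).and (Filter.Eventually.and ?_ ?_)
    · exact (Real.tendsto_log_atTop.comp tendsto_natCast_atTop_atTop).eventually_ge_atTop 1
    · have h := (Real.isLittleO_log_id_atTop.comp_tendsto
        (tendsto_natCast_atTop_atTop (R := ℝ))).bound (c := (K ^ 2)⁻¹) (by positivity)
      filter_upwards [h] with k hk
      simp only [Function.comp_apply, id_eq, Real.norm_eq_abs, Nat.abs_cast] at hk
      have := (le_abs_self _).trans hk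
      rwa [inv_mul_eq_div, le_div_iff₀ (by positivity), mul_comm] at this
  obtain ⟨k₀, hk₀⟩ := Filter.eventually_atTop.mp hlarge
  -- 2K pays for the final set, 36 for the halving rounds, and 4^k₀ for Ramsey when k < k₀.
  refine ⟨2 * K + 36 + 4 ^ k₀, K⁻¹, by positivity, by positivity, ?_⟩
  intro k hk V _ _ G _ hV
  have hk' : (2 : ℝ) ≤ k := by exact_mod_cast hk
  have hlog2 : 1 / 2 ≤ Real.log k := by
    have := Real.log_le_log two_pos hk'
    linarith [Real.log_two_gt_d9]
  refine exists_minDegree_of_hasRowSumSet G (by omega) ?_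
  rcases le_or_gt k₀ k with h | h
  · obtain ⟨h7, h1, hKL⟩ := hk₀ k h
    refine hasRowSumSet_or_neg (isSignKernel_adjSign G) hK h7 h1 hKL (le_trans ?_ hV)
    have : (0 : ℝ) ≤ 4 ^ k₀ * k * Real.log k := by positivity
    linarith
  · have hcard : 2 ^ (k + k) ≤ (Finset.univ : Finset V).card := by
      have h1 : (4 : ℝ) ^ k ≤ 4 ^ k₀ := pow_le_pow_right₀ (by norm_num) h.le
      have h2 : 1 ≤ (k : ℝ) * Real.log k := by nlinarith
      have h3 : (4 : ℝ) ^ k ≤ Fintype.card V := by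
        have h4 : (0 : ℝ) < 4 ^ k₀ := by positivity
        nlinarith
      rw [Finset.card_univ, ← two_mul, pow_mul]
      exact_mod_cast h3
    -- A clique has row sums k − 1, which dominates the target since log k ≥ 1/2.
    have hle : 2 * (K⁻¹ * Real.sqrt ((k - 1) / Real.log k)) ≤ (k : ℝ) - 1 := by
      have hKinv : K⁻¹ ≤ 1 / 4 := by
        rw [inv_le_comm₀ (by linarith) (by norm_num)]; linarith
      have h1 : Real.sqrt ((k - 1) / Real.log k) ≤ 2 * (k - 1) := by
        refine Real.sqrt_le_iff.mpr ⟨by linarith, ?_⟩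
        rw [div_le_iff₀ (by linarith)]
        nlinarith [mul_nonneg (by linarith : (0 : ℝ) ≤ k - 1) (by linarith : (0 : ℝ) ≤ k - 2),
          mul_le_mul_of_nonneg_left hlog2 (sq_nonneg ((k : ℝ) - 1))]
      have h2 := mul_le_mul hKinv h1 (Real.sqrt_nonneg _) (by norm_num)
      linarith
    obtain ⟨T, -, hT | hT⟩ := exists_isNClique_or_compl G k k Finset.univ hcard
    · exact Or.inl ((HasRowSumSet.of_isNClique G hT).mono hle)
    · rw [← adjSign_compl]
      exact Or.inr ((HasRowSumSet.of_isNClique Gᶜ hT).mono hle)
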